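/- Fix $\theta>0$ and $\mu_0\in\mathbb R$. For $\Omega\in(0,1]$ put $C=C(\Omega)=\frac{(1-\Omega)^2}{4\Omega}$. For $m,l\in\mathbb N$, $h\in\mathbb Z$ with $m+h\ge 0$, $l+h\ge 0$, and $\alpha\in(0,1)$, let $$G^{(\alpha)}_{m,m+h;l+h,l}=\Big(\tfrac{\sqrt{1-\alpha}}{1+C\alpha}\Big)^{m+l+h}\sum_{u=\max(0,-h)}^{\min(m,l)}\mathcal A(m,l,h,u)\Big(\tfrac{C\alpha(1+\Omega)}{\sqrt{1-\alpha}\,(1-\Omega)}\Big)^{m+l-2u},$$ $$\mathcal A(m,l,h,u)=\sqrt{\tbinom{m}{m-u}\tbinom{m+h}{m-u}\tbinom{l}{l-u}\tbinom{l+h}{l-u}},$$ where at $\Omega=1$ the last ratio is understood as its limit $\frac{\alpha(1-\Omega^2)}{4\Omega\sqrt{1-\alpha}}=0$ (and $0^0=1$). For $M>1$, a slice $i\ge 1$, and $m,n,k,l\in\mathbb N^2$, the sliced propagator of the $\Phi^4_4$ model in the matrix basis is $G^i_{m,n;k,l}=0$ if $m+k\neq n+l$, and otherwise, with $h=n-m=k-l\in\mathbb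 Z^2$, $$G^i_{m,m+h;l+h,l}=\frac{\theta}{8\Omega}\int_{M^{-2i}}^{M^{-2(i-1)}}d\alpha\,\frac{(1-\alpha)^{\mu_0^2\theta/(8\Omega)}}{(1+C\alpha)^2}\prod_{s=1}^{2}G^{(\alpha)}_{m^s,m^s+h^s;l^s+h^s,l^s}.$$ Write $\|v\|=|v^1|+|v^2|$; inequalities and maxima between elements of $\mathbb Z^2$ are componentwise. There is $M_0>1$ such that for every real $M\ge M_0$ the following hold. 1. There is $K>0$ such that for all $\Omega\in[\frac12,1]$, all $i\ge1$ and all $m,l\in\mathbb N^2$, $h\in\mathbb Z^2$ with $m+h,l+h\in\mathbb N^2$, $$G^i_{m,m+h;l+h,l}\le K M^{-2i}e^{-\frac{\Omega}{3}M^{-2i}\|m+l+h\|}.$$ 2. There are $K,K_1>0$ such that for all $\Omega\in[\frac12,1]$ and all $i,m,l,h$ as in 1, $$G^i_{m,m+h;l+h,l}\le K M^{-2i}e^{-\frac{\Omega}{4}M^{-2i}\|m+l+h\|}\prod_{s=1}^{2}\min\Big(1,\Big(\tfrac{K_1\max\left(1,\min(m^s,l^s,m^s+h^s,l^s+h^s)\right)}{M^{2i}}\Big)^{\frac{|m^s-l^s|}{2}}\Big).$$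 3. There is $K>0$ such that for all $\Omega\in[\frac23,1]$, $i\ge1$ and $m,p\in\mathbb N^2$, $$\sum_{l\in\mathbb Z^2,\,-m\le l\le p}G^i_{m,p-l;p,m+l}\le K M^{-2i}e^{-\frac{\Omega}{4}M^{-2i}(\|p\|+\|m\|)}.$$ 4. There is $K>0$ such that for all $\Omega\in[\frac23,1]$, $i\ge1$ and $m\in\mathbb N^2$, the maxima below are attained, the series converges, and $$\sum_{l\in\mathbb Z^2,\,l\ge-m}\ \max_{p\in\mathbb N^2,\,p\ge\max(l,0)}G^i_{m,p-l;p,m+l}\le K M^{-2i}e^{-\frac{\Omega}{36}M^{-2i}\|m\|}.$$ 5. Let $\delta_0$ and $\delta_1$ be the largest real exponents for which there is a constant $K$ (which may depend on $\Omega$) such that, for all $i\ge1$, respectively $$|G^i_{m,n;k,l}|\le K M^{-i\delta_0}\,\delta_{m+k,n+l}\ \ (m,n,k,l\in\mathbb N^2),\qquad \sup_m\sum_l\sup_{n,k}|G^i_{m,n;k,l}|\le K M^{-i\delta_1}.$$ Then $\delta_0=2$ (the largest exponent exists) for every $\Omega\in[\frac12,1]$, and $\delta_0=\delta_1=2$,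 i.e. the model is regular, for every $\Omega\in[\frac23,1]$. -/

import Mathlib

open scoped BigOperators ENNReal

noncomputable section

namespace MatrixPhi4

/-- Matrix indices of the four-dimensional model: pairs of natural numbers, one for each
symplectic pair of coordinates (`D / 2 = 2`). -/
abbrev Idx : Type := Fin 2 → ℕ

/-- The norm `‖v‖ = |v¹| + |v²|` on `ℤ²`. -/
def norm1 (v : Fin 2 → ℤ) : ℝ := ∑ s, |(v s : ℝ)|

/-- A pair of integers seen as a matrix index (used only when both components are `≥ 0`). -/
def toIdx (v : Fin 2 → ℤ) : Idx := fun s => (v s).toNat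

/-- `C(Ω) = (1 - Ω)² / (4 Ω)`. -/
def constC (Ω : ℝ) : ℝ := (1 - Ω) ^ 2 / (4 * Ω)

/-- The ratio `C α (1 + Ω) / (√(1 - α) (1 - Ω))`, written as
`α (1 - Ω²) / (4 Ω √(1 - α))` so that it also makes sense at `Ω = 1`, where it vanishes
(see `hopRatio_eq`). -/
def hopRatio (Ω α : ℝ) : ℝ := α * (1 - Ω ^ 2) / (4 * Ω * √(1 - α))

theorem hopRatio_eq (Ω α : ℝ) (hΩ : Ω ≠ 1) :
    hopRatio Ω α = constC Ω * α * (1 + Ω) / (√(1 - α) * (1 - Ω)) := by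
  have h1 : (1 - Ω) ≠ 0 := sub_ne_zero.mpr (Ne.symm hΩ)
  unfold hopRatio constC
  rcases eq_or_ne Ω 0 with h0 | h0
  · simp [h0]
  rcases eq_or_ne (√(1 - α)) 0 with h2 | h2
  · simp [h2]
  field_simp
  ring

/-- The combinatorial factor `𝒜(m,l,h,u)`, with `n = m + h` and `k = l + h`. -/
def combA (m n k l u : ℕ) : ℝ :=
  √((m.choose (m - u) : ℝ) * (n.choose (m - u) : ℝ) *
    (l.choose (l - u) : ℝ) * (k.choose (l - u) : ℝ))

/-- The one-dimensional kernel `G^{(α)}_{m,n;k,l}`, for `n = m + h` and `k = l + h` with `h ∈ ℤ`.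
Then `m + l + h = m + k`, and the truncated difference `m - n` is `max(0, -h)`. -/
def kernel (Ω α : ℝ) (m n k l : ℕ) : ℝ :=
  (√(1 - α) / (1 + constC Ω * α)) ^ (m + k) *
    ∑ u ∈ Finset.Icc (m - n) (min m l), combA m n k l u * hopRatio Ω α ^ (m + l - 2 * u)

/-- The propagator `G^i_{mn;kl}` of the `Φ⁴₄` model in the slice `i ≥ 1`: the Schwinger parameter
`α ∈ [0,1]` of the full propagator is restricted to `[M^{-2i}, M^{-2(i-1)}]`. It vanishes unless
`m + k = n + l`. For `D = 4` the exponent `μ₀²θ/(8Ω) + (D/4 - 1)` is `μ₀²θ/(8Ω)`. -/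
def slice (θ μ₀ Ω M : ℝ) (i : ℕ) (m n k l : Idx) : ℝ :=
  if m + k = n + l then
    θ / (8 * Ω) * ∫ α in (M ^ (-2 * (i : ℤ)))..(M ^ (-2 * ((i : ℤ) - 1))),
      (1 - α) ^ (μ₀ ^ 2 * θ / (8 * Ω)) / (1 + constC Ω * α) ^ 2 *
        ∏ s, kernel Ω α (m s) (n s) (k s) (l s)
  else 0

/-- The exponents `δ` for which `max_{m,n,k,l} |Q^i_{mn;kl}| ≤ C M^{-iδ} δ_{m+k,n+l}` holds for
some constant `C` and all slices `i ≥ 1`. -/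
def exponents0 (M : ℝ) (Q : ℕ → Idx → Idx → Idx → Idx → ℝ) : Set ℝ :=
  {δ | ∃ C : ℝ, ∀ i : ℕ, 1 ≤ i → ∀ m n k l : Idx,
    |Q i m n k l| ≤ if m + k = n + l then C * M ^ (-((i : ℝ) * δ)) else 0}

/-- The exponents `δ` for which `max_m ∑_l max_{n,k} |Q^i_{mn;kl}| ≤ C M^{-iδ}` holds for
some constant `C` and all slices `i ≥ 1` (suprema and sums in `[0,∞]`). -/
def exponents1 (M : ℝ) (Q : ℕ → Idx → Idx → Idx → Idx → ℝ) : Set ℝ :=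
  {δ | ∃ C : ℝ, ∀ i : ℕ, 1 ≤ i →
    (⨆ m : Idx, ∑' l : Idx, ⨆ n : Idx, ⨆ k : Idx, ENNReal.ofReal |Q i m n k l|) ≤
      ENNReal.ofReal (C * M ^ (-((i : ℝ) * δ)))}

/-- The scaling exponent `δ₀` of `Q`, the best exponent in the first bound, equals `δ`. -/
def HasDelta0 (M : ℝ) (Q : ℕ → Idx → Idx → Idx → Idx → ℝ) (δ : ℝ) : Prop :=
  IsGreatest (exponents0 M Q) δ

/-- The scaling exponent `δ₁` of `Q`, the best exponent in the second bound, equals `δ`. -/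
def HasDelta1 (M : ℝ) (Q : ℕ → Idx → Idx → Idx → Idx → ℝ) (δ : ℝ) : Prop :=
  IsGreatest (exponents1 M Q) δ

/-- A matrix model with sliced propagator `Q` is regular if `δ₀ = δ₁ = 2`. -/
def IsRegular (M : ℝ) (Q : ℕ → Idx → Idx → Idx → Idx → ℝ) : Prop :=
  HasDelta0 M Q 2 ∧ HasDelta1 M Q 2

end MatrixPhi4

end

namespace MatrixPhi4

/-! Write `r` for the base `√(1-α)/(1+Cα)`, `x` for `hopRatio` and, after a symmetry, `l = m + D`,
`k = n + D`. With `a = m - u` the kernel is `r^(m+k)` times a sum of square roots of four binomials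
times `x^(2a+D)`. AM-GM pairs these binomials so that each half is a diagonal part of the product of
two binomial expansions; hence the kernel is at most `(r(1+x))^(m+k)`, and with a weight `c^D` at
most `(r(1+cx))^(m+k)` (`pow_mul_kernel_le`). An elementary inequality in `Ω` gives `r(1+cx) ≤
exp(-dΩα)` (`base_mul_le_exp`). The choice `c = 1` yields the uniform bound; `c = 3/2`, possible for
`Ω ≥ 2/3`, yields in addition the decay `(2/3)^|m-l|`, which makes sums over the jump converge.

For the refined bound, `C(m+D,D) C(n+D,D)` is pulled out of the square root. One binomial is at most
`(m+1)^D`; the other, against a small part of `x^(2D)`, is absorbed by the spare exponential decay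
(`kernel_le_min`).

On a slice `α` is comparable to `M^(-2i)` up to a factor `M^2`, and the interval has length at most
`M^2 M^(-2i)`, so pointwise bounds become slice bounds (`slice_le`). The exponents cannot exceed 2
because the entry with all indices zero, where the kernel is 1, is at least a constant times
`M^(-2i)`. -/

/-! ### Symmetries and reindexing of the kernel -/

theorem kernel_swap (Ω α : ℝ) {m n k l : ℕ} (h : m + k = n + l) :
    kernel Ω α m n k l = kernel Ω α l k n m := by
  unfold kernel
  have h1 : m - n = l - k := by omega
  rw [h1, min_comm m l, h, add_comm n l, add_comm m l]
  congr 1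
  refine Finset.sum_congr rfl fun u _ => ?_
  unfold combA
  congr 2
  ring

theorem kernel_add (Ω α : ℝ) (m n D : ℕ) :
    kernel Ω α m n (n + D) (m + D) =
      (√(1 - α) / (1 + constC Ω * α)) ^ (m + n + D) *
        ∑ a ∈ Finset.range (min m n + 1),
          √((m.choose a : ℝ) * n.choose a * (m + D).choose (a + D) * (n + D).choose (a + D)) *
            hopRatio Ω α ^ (2 * a + D) := by
  unfold kernel
  rw [← add_assoc]
  congr 1
  refine Finset.sum_nbij' (fun u => m - u) (fun a => m - a) ?_ ?_ ?_ ?_ ?_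
  · intro u hu
    simp only [Finset.mem_Icc, Finset.mem_range] at *
    omega
  · intro u hu
    simp only [Finset.mem_Icc, Finset.mem_range] at *
    omega
  · intro u hu
    simp only [Finset.mem_Icc] at *
    omega
  · intro u hu
    simp only [Finset.mem_range] at *
    omega
  · intro u hu
    simp only [Finset.mem_Icc] at hu
    have h1 : m + D - u = m - u + D := by omega
    have h2 : m + (m + D) - 2 * u = 2 * (m - u) + D := by omega
    rw [h2]
    unfold combA
    rw [h1]

theorem kernel_transpose (Ω α : ℝ) (m n D : ℕ) :
    kernel Ω α m n (n + D) (m + D) = kernel Ω α n m (m + D) (n + D) := by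
  rw [kernel_add, kernel_add, min_comm, add_comm m n]
  congr 1
  refine Finset.sum_congr rfl fun a _ => ?_
  congr 2
  ring

/-! ### Binomial sums -/

theorem sum_choose_mul_pow_le {x : ℝ} (hx : 0 ≤ x) (N D j : ℕ) :
    ∑ a ∈ Finset.range j, (N.choose (a + D) : ℝ) * x ^ (a + D) ≤ (1 + x) ^ N := by
  have h1 : (1 + x) ^ N = ∑ b ∈ Finset.range (N + 1), (N.choose b : ℝ) * x ^ b := by
    rw [add_comm, add_pow]
    refine Finset.sum_congr rfl fun b _ => ?_
    simp [mul_comm]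
  have h2 : ∑ a ∈ Finset.range j, (N.choose (a + D) : ℝ) * x ^ (a + D) =
      ∑ b ∈ (Finset.range j).map (addRightEmbedding D), (N.choose b : ℝ) * x ^ b := by
    rw [Finset.sum_map]; rfl
  rw [h1, h2, ← Finset.sum_filter_of_ne (p := fun b => b ≤ N)]
  · refine Finset.sum_le_sum_of_subset_of_nonneg ?_ fun _ _ _ => by positivity
    intro b hb
    simp only [Finset.mem_filter] at hb
    simp only [Finset.mem_range]
    omega
  · intro b _ hb
    by_contra hlt
    exact hb (by rw [Nat.choose_eq_zero_of_lt (not_le.mp hlt)]; simp)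

/-- The left side is a diagonal part of the product of the expansions of `(1+x)^M` and `(1+x)^N`,
whose terms are all nonnegative. -/
theorem sum_choose_mul_choose_le {x : ℝ} (hx : 0 ≤ x) (M N D j : ℕ) :
    ∑ a ∈ Finset.range j, (M.choose a : ℝ) * N.choose (a + D) * x ^ (2 * a + D) ≤
      (1 + x) ^ (M + N) := by
  calc ∑ a ∈ Finset.range j, (M.choose a : ℝ) * N.choose (a + D) * x ^ (2 * a + D)
      = ∑ a ∈ Finset.range j, ((M.choose a : ℝ) * x ^ a) * (N.choose (a + D) * x ^ (a + D)) := by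
        refine Finset.sum_congr rfl fun a _ => ?_
        ring
    _ ≤ (∑ a ∈ Finset.range j, (M.choose a : ℝ) * x ^ a) *
          ∑ a ∈ Finset.range j, (N.choose (a + D) : ℝ) * x ^ (a + D) := by
        rw [Finset.sum_mul]
        refine Finset.sum_le_sum fun a ha => mul_le_mul_of_nonneg_left ?_ (by positivity)
        exact Finset.single_le_sum (f := fun a => (N.choose (a + D) : ℝ) * x ^ (a + D))
          (fun _ _ => by positivity) ha
    _ ≤ (1 + x) ^ M * (1 + x) ^ N := by
        refine mul_le_mul ?_ (sum_choose_mul_pow_le hx N D j)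
          (Finset.sum_nonneg fun _ _ => by positivity) (by positivity)
        simpa using sum_choose_mul_pow_le hx M 0 j
    _ = _ := (pow_add _ _ _).symm

theorem sqrt_mul_mul_mul_le {a b c d : ℝ} (ha : 0 ≤ a) (hb : 0 ≤ b) (hc : 0 ≤ c) (hd : 0 ≤ d) :
    √(a * b * c * d) ≤ (a * d + b * c) / 2 := by
  refine Real.sqrt_le_iff.mpr ⟨by positivity, ?_⟩
  nlinarith [sq_nonneg (a * d - b * c)]

/-! ### Exponential bounds on the kernel -/

section bounds

variable {Ω α : ℝ}

theorem constC_nonneg (hΩ : 0 < Ω) : 0 ≤ constC Ω := by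
  unfold constC; positivity

theorem base_nonneg (hΩ : 0 < Ω) (hα : 0 ≤ α) : 0 ≤ √(1 - α) / (1 + constC Ω * α) := by
  have := constC_nonneg hΩ
  positivity

theorem hopRatio_nonneg (hΩ : 0 < Ω) (hΩ1 : Ω ≤ 1) (hα : 0 ≤ α) : 0 ≤ hopRatio Ω α := by
  have : 0 ≤ 1 - Ω ^ 2 := by nlinarith
  unfold hopRatio; positivity

theorem kernel_nonneg (hΩ : 0 < Ω) (hΩ1 : Ω ≤ 1) (hα : 0 ≤ α) (m n k l : ℕ) :
    0 ≤ kernel Ω α m n k l := by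
  have h1 := base_nonneg hΩ hα
  have h2 := hopRatio_nonneg hΩ hΩ1 hα
  exact mul_nonneg (pow_nonneg h1 _) (Finset.sum_nonneg fun u _ =>
    mul_nonneg (Real.sqrt_nonneg _) (pow_nonneg h2 _))

/-- Since `c ≥ 1`, the weight satisfies `c^D ≤ c^(2a+D)` and merges with the powers of `hopRatio`.
AM-GM pairs `C(m,a)` with `C(n+D,a+D)`, and `C(n,a)` with `C(m+D,a+D)`, so that both resulting sums
carry the exponent `m+n+D`. -/
theorem pow_mul_kernel_add_le (hΩ : 0 < Ω) (hΩ1 : Ω ≤ 1) (hα : 0 ≤ α) {c : ℝ} (hc : 1 ≤ c)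
    (m n D : ℕ) :
    c ^ D * kernel Ω α m n (n + D) (m + D) ≤
      (√(1 - α) / (1 + constC Ω * α) * (1 + c * hopRatio Ω α)) ^ (m + n + D) := by
  have h1 := base_nonneg hΩ hα
  have h2 := hopRatio_nonneg hΩ hΩ1 hα
  have hx : 0 ≤ c * hopRatio Ω α := by positivity
  rw [kernel_add, mul_pow, mul_left_comm]
  refine mul_le_mul_of_nonneg_left ?_ (by positivity)
  rw [Finset.mul_sum]
  have key : ∀ a ∈ Finset.range (min m n + 1),
      c ^ D * (√((m.choose a : ℝ) * n.choose a * (m + D).choose (a + D) *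
        (n + D).choose (a + D)) * hopRatio Ω α ^ (2 * a + D)) ≤
      1 / 2 * ((m.choose a : ℝ) * (n + D).choose (a + D) * (c * hopRatio Ω α) ^ (2 * a + D)) +
      1 / 2 * ((n.choose a : ℝ) * (m + D).choose (a + D) * (c * hopRatio Ω α) ^ (2 * a + D)) := by
    intro a _
    have h3 := sqrt_mul_mul_mul_le (a := (m.choose a : ℝ)) (b := n.choose a)
      (c := (m + D).choose (a + D)) (d := (n + D).choose (a + D))
      (by positivity) (by positivity) (by positivity) (by positivity)
    have h4 : c ^ D ≤ c ^ (2 * a + D) := pow_le_pow_right₀ hc (by omega)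
    rw [mul_pow, ← mul_add, ← add_mul]
    calc _ ≤ c ^ (2 * a + D) * ((((m.choose a : ℝ) * (n + D).choose (a + D) +
          n.choose a * (m + D).choose (a + D)) / 2) * hopRatio Ω α ^ (2 * a + D)) := by gcongr
      _ = _ := by ring
  refine (Finset.sum_le_sum key).trans ?_
  rw [Finset.sum_add_distrib, ← Finset.mul_sum, ← Finset.mul_sum]
  have e1 := sum_choose_mul_choose_le hx m (n + D) D (min m n + 1)
  have e2 := sum_choose_mul_choose_le hx n (m + D) D (min m n + 1)
  rw [← add_assoc] at e1
  rw [← add_assoc, add_comm n m] at e2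
  linarith

theorem pow_mul_kernel_le (hΩ : 0 < Ω) (hΩ1 : Ω ≤ 1) (hα : 0 ≤ α) {c : ℝ} (hc : 1 ≤ c)
    {m n k l : ℕ} (h : m + k = n + l) :
    c ^ ((m : ℤ) - l).natAbs * kernel Ω α m n k l ≤
      (√(1 - α) / (1 + constC Ω * α) * (1 + c * hopRatio Ω α)) ^ (m + k) := by
  rcases le_total m l with hml | hml
  · obtain ⟨D, rfl⟩ := Nat.exists_eq_add_of_le hml
    obtain rfl : k = n + D := by omega
    have : ((m : ℤ) - ((m + D : ℕ) : ℤ)).natAbs = D := by omega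
    rw [this, ← add_assoc]
    exact pow_mul_kernel_add_le hΩ hΩ1 hα hc m n D
  · obtain ⟨D, rfl⟩ := Nat.exists_eq_add_of_le hml
    obtain rfl : n = k + D := by omega
    have : (((l + D : ℕ) : ℤ) - (l : ℤ)).natAbs = D := by omega
    rw [this, kernel_swap Ω α h, show l + D + k = l + k + D by ring]
    exact pow_mul_kernel_add_le hΩ hΩ1 hα hc l k D

theorem base_mul_le {c : ℝ} (hΩ : 0 < Ω) (hΩ1 : Ω ≤ 1) (hα : 0 ≤ α) (hα1 : α ≤ 1) (hc : 0 ≤ c) :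
    √(1 - α) / (1 + constC Ω * α) * (1 + c * hopRatio Ω α) ≤
      (1 - α / 2 + c * ((1 - Ω ^ 2) / (4 * Ω)) * α) / (1 + constC Ω * α) := by
  have h0 := constC_nonneg hΩ
  have h1 : √(1 - α) ≤ 1 - α / 2 := by
    refine Real.sqrt_le_iff.mpr ⟨by linarith, ?_⟩
    nlinarith [sq_nonneg α]
  have h3 : 0 ≤ 1 - Ω ^ 2 := by nlinarith
  have h2 : √(1 - α) * hopRatio Ω α ≤ (1 - Ω ^ 2) / (4 * Ω) * α := by
    unfold hopRatio
    -- At `α = 1` division by zero makes `hopRatio` vanish; otherwise the square roots cancel and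
    -- equality holds.
    rcases eq_or_ne (√(1 - α)) 0 with h | h
    · rw [h]; simp; positivity
    · refine le_of_eq ?_
      field_simp
  rw [div_mul_eq_mul_div]
  gcongr
  nlinarith [mul_le_mul_of_nonneg_left h2 hc]

/-- After `base_mul_le`, it suffices that `1 - α/2 + cqα ≤ (1 - dΩα)(1 + Cα)` with `q =
(1-Ω²)/(4Ω)`. Dividing by `α`, the worst case is `α = 1`; multiplying that by `4Ω` gives the
hypothesis, as `(1-Ω)² + 2Ω = 1 + Ω²`. -/
theorem base_mul_le_exp {c d : ℝ} (hΩ : 0 < Ω) (hΩ1 : Ω ≤ 1) (hα : 0 ≤ α) (hα1 : α ≤ 1)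
    (hc : 0 ≤ c) (hd : 0 ≤ d)
    (h : c * (1 - Ω ^ 2) + 4 * d * Ω ^ 2 + d * Ω * (1 - Ω) ^ 2 ≤ 1 + Ω ^ 2) :
    √(1 - α) / (1 + constC Ω * α) * (1 + c * hopRatio Ω α) ≤ Real.exp (-(d * Ω * α)) := by
  have h0 := constC_nonneg hΩ
  refine (base_mul_le hΩ hΩ1 hα hα1 hc).trans (le_trans ?_ (Real.one_sub_le_exp_neg _))
  rw [div_le_iff₀ (by positivity)]
  have h4 : constC Ω * (4 * Ω) = (1 - Ω) ^ 2 := by unfold constC; field_simp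
  have h5 : (1 - Ω ^ 2) / (4 * Ω) * (4 * Ω) = 1 - Ω ^ 2 := by field_simp
  generalize constC Ω = C at *
  generalize (1 - Ω ^ 2) / (4 * Ω) = q at *
  have h6 : (c * q) * (4 * Ω) ≤ (C + 1 / 2 - d * Ω - d * Ω * C) * (4 * Ω) := by
    have : (C + 1 / 2 - d * Ω - d * Ω * C) * (4 * Ω) =
      C * (4 * Ω) + 2 * Ω - 4 * d * Ω ^ 2 - d * Ω * (C * (4 * Ω)) := by ring
    rw [this, mul_assoc, h5, h4]
    nlinarith
  have h7 : c * q ≤ C + 1 / 2 - d * Ω - d * Ω * C := le_of_mul_le_mul_right h6 (by positivity)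
  have h8 := mul_le_mul_of_nonneg_right h7 hα
  have h9 : 0 ≤ d * Ω * C * (α * (1 - α)) :=
    mul_nonneg (by positivity) (mul_nonneg hα (by linarith))
  nlinarith

theorem base_mul_one_le_exp (hΩ : Ω ∈ Set.Icc (1 / 2 : ℝ) 1) (hα : 0 ≤ α) (hα1 : α ≤ 1) :
    √(1 - α) / (1 + constC Ω * α) * (1 + hopRatio Ω α) ≤ Real.exp (-(4 / 9 * Ω * α)) := by
  obtain ⟨h1, h2⟩ := hΩ
  -- With `c = 1` and `d = 4/9` the condition is an equality at `Ω = 1/2`.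
  have := base_mul_le_exp (c := 1) (d := 4 / 9) (by linarith : (0 : ℝ) < Ω) h2 hα hα1
    (by norm_num) (by norm_num) (by nlinarith [mul_nonneg (sub_nonneg.2 h1) (sub_nonneg.2 h2)])
  rwa [one_mul] at this

theorem base_mul_three_halves_le_exp (hΩ : Ω ∈ Set.Icc (2 / 3 : ℝ) 1) (hα : 0 ≤ α) (hα1 : α ≤ 1) :
    √(1 - α) / (1 + constC Ω * α) * (1 + 3 / 2 * hopRatio Ω α) ≤
      Real.exp (-(1 / 4 * Ω * α)) := by
  obtain ⟨h1, h2⟩ := hΩ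
  exact base_mul_le_exp (by linarith) h2 hα hα1
    (by norm_num) (by norm_num) (by nlinarith [mul_nonneg (sub_nonneg.2 h1) (sub_nonneg.2 h2)])

theorem kernel_le_exp (hΩ : Ω ∈ Set.Icc (1 / 2 : ℝ) 1) (hα : 0 ≤ α) (hα1 : α ≤ 1)
    {m n k l : ℕ} (h : m + k = n + l) :
    kernel Ω α m n k l ≤ Real.exp (-(4 / 9 * Ω * α) * (m + k : ℕ)) := by
  have hΩ0 : 0 < Ω := by linarith [hΩ.1]
  have h1 := pow_mul_kernel_le hΩ0 hΩ.2 hα le_rfl h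
  rw [one_pow, one_mul, one_mul] at h1
  rw [mul_comm, Real.exp_nat_mul]
  have h2 := base_nonneg hΩ0 hα
  have h3 := hopRatio_nonneg hΩ0 hΩ.2 hα
  exact h1.trans (pow_le_pow_left₀ (by positivity) (base_mul_one_le_exp hΩ hα hα1) _)

theorem kernel_le_jump (hΩ : Ω ∈ Set.Icc (2 / 3 : ℝ) 1) (hα : 0 ≤ α) (hα1 : α ≤ 1)
    {m n k l : ℕ} (h : m + k = n + l) :
    kernel Ω α m n k l ≤
      Real.exp (-(1 / 4 * Ω * α) * (m + k : ℕ)) * (2 / 3) ^ ((m : ℤ) - l).natAbs := by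
  have hΩ0 : 0 < Ω := by linarith [hΩ.1]
  have h1 := pow_mul_kernel_le hΩ0 hΩ.2 hα (by norm_num : (1 : ℝ) ≤ 3 / 2) h
  rw [mul_comm _ ((m + k : ℕ) : ℝ), Real.exp_nat_mul]
  have h2 := base_nonneg hΩ0 hα
  have h3 := hopRatio_nonneg hΩ0 hΩ.2 hα
  have h4 := h1.trans (pow_le_pow_left₀ (by positivity) (base_mul_three_halves_le_exp hΩ hα hα1) _)
  rw [show (2 / 3 : ℝ) = (3 / 2)⁻¹ by norm_num, inv_pow, ← div_eq_mul_inv, le_div_iff₀ (by positivity),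
    mul_comm]
  exact h4

/-! ### Refined kernel bound for small `α` -/

/-- For `a ≤ m`, `C(m+D,a+D) C(a+D,D) = C(m+D,D) C(m,a)`, and the second factor on the left is at
least 1. -/
theorem choose_add_le (m D a : ℕ) :
    (m + D).choose (a + D) ≤ (m + D).choose D * m.choose a := by
  rcases le_or_gt a m with h | h
  · have := Nat.choose_mul (n := m + D) (k := a + D) (s := D) (by omega)
    simp only [Nat.add_sub_cancel] at this
    rw [← this]
    exact Nat.le_mul_of_pos_right _ (Nat.choose_pos (by omega))
  · rw [Nat.choose_eq_zero_of_lt (by omega)]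
    exact Nat.zero_le _

theorem choose_add_self_le (m D : ℕ) : (m + D).choose D ≤ (m + 1) ^ D := by
  induction D with
  | zero => simp
  | succ D ih =>
    have h1 := Nat.add_one_mul_choose_eq (m + D) D
    have h2 : (m + D + 1) ≤ (m + 1) * (D + 1) := by nlinarith [Nat.zero_le (m * D)]
    refine Nat.le_of_mul_le_mul_right (c := D + 1) ?_ (Nat.succ_pos D)
    calc (m + (D + 1)).choose (D + 1) * (D + 1) = (m + D + 1) * (m + D).choose D := h1.symm
      _ ≤ ((m + 1) * (D + 1)) * (m + 1) ^ D := Nat.mul_le_mul h2 ih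
      _ = _ := by ring

theorem kernel_add_le_sqrt (hΩ : 0 < Ω) (hΩ1 : Ω ≤ 1) (hα : 0 ≤ α) (m n D : ℕ) :
    kernel Ω α m n (n + D) (m + D) ≤
      (√(1 - α) / (1 + constC Ω * α)) ^ (m + n + D) * ((1 + hopRatio Ω α) ^ (m + n) *
        (√((m + D).choose D * (n + D).choose D) * hopRatio Ω α ^ D)) := by
  have h1 := base_nonneg hΩ hα
  have h2 := hopRatio_nonneg hΩ hΩ1 hα
  rw [kernel_add]
  refine mul_le_mul_of_nonneg_left ?_ (by positivity)
  have h3 := sum_choose_mul_choose_le h2 m n 0 (min m n + 1)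
  simp only [add_zero] at h3
  refine le_trans ?_ (mul_le_mul_of_nonneg_right h3 (by positivity))
  rw [Finset.sum_mul]
  refine Finset.sum_le_sum fun a _ => ?_
  have h4 : √((m.choose a : ℝ) * n.choose a * (m + D).choose (a + D) * (n + D).choose (a + D)) ≤
      m.choose a * n.choose a * √((m + D).choose D * (n + D).choose D) := by
    refine Real.sqrt_le_iff.mpr ⟨by positivity, ?_⟩
    rw [mul_pow, Real.sq_sqrt (by positivity)]
    have e1 : ((m + D).choose (a + D) : ℝ) ≤ (m + D).choose D * m.choose a := by
      exact_mod_cast choose_add_le m D a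
    have e2 : ((n + D).choose (a + D) : ℝ) ≤ (n + D).choose D * n.choose a := by
      exact_mod_cast choose_add_le n D a
    calc _ ≤ (m.choose a : ℝ) * n.choose a * ((m + D).choose D * m.choose a) *
          ((n + D).choose D * n.choose a) := by gcongr
      _ = _ := by ring
  calc _ ≤ m.choose a * n.choose a * √((m + D).choose D * (n + D).choose D) *
        hopRatio Ω α ^ (2 * a + D) := by gcongr
    _ = _ := by ring

theorem hopRatio_le (hΩ : Ω ∈ Set.Icc (1 / 2 : ℝ) 1) (hα : 0 ≤ α) (hα1 : α ≤ 1 / 2) :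
    hopRatio Ω α ≤ 5 / 8 * α := by
  obtain ⟨h1, h2⟩ := hΩ
  have h3 : (3 / 5 : ℝ) ≤ √(1 - α) := Real.le_sqrt_of_sq_le (by nlinarith)
  unfold hopRatio
  rw [div_le_iff₀ (by positivity)]
  have h4 : 1 - Ω ^ 2 ≤ 3 / 2 * Ω := by nlinarith
  have h5 : 3 / 2 * Ω ≤ 5 / 8 * (4 * Ω * √(1 - α)) := by nlinarith
  nlinarith [mul_le_mul_of_nonneg_left (h4.trans h5) hα]

theorem kernel_add_le_min (hΩ : Ω ∈ Set.Icc (1 / 2 : ℝ) 1) (hα : 0 ≤ α) (hα1 : α ≤ 1 / 2)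
    (m n D : ℕ) :
    kernel Ω α m n (n + D) (m + D) ≤
      Real.exp (-(1 / 4 * Ω * α) * (m + n + D : ℕ)) * √((5 * (max 1 m : ℕ) * α) ^ D) := by
  have hΩ0 : 0 < Ω := by linarith [hΩ.1]
  have h1 := base_nonneg hΩ0 hα
  have h2 := hopRatio_nonneg hΩ0 hΩ.2 hα
  have h3 := hopRatio_le hΩ hα hα1
  have h4 := base_mul_one_le_exp hΩ hα (by linarith)
  refine (kernel_add_le_sqrt hΩ0 hΩ.2 hα m n D).trans ?_
  set r := √(1 - α) / (1 + constC Ω * α)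
  set x := hopRatio Ω α
  -- The power `x^(2D)` is split as `(x/4)^D (4x)^D`. The small part absorbs `C(n+D,D)`, as one term
  -- of a binomial expansion; the large part goes with `C(m+D,D)`, and `2 · 4 · 5/8 = 5` gives the
  -- constant of the statement.
  have e1 : ((n + D).choose D : ℝ) * (x / 4) ^ D ≤ (1 + x / 4) ^ (n + D) := by
    have := sum_choose_mul_pow_le (x := x / 4) (by positivity) (n + D) D 1
    simpa using this
  have e2 : ((m + D).choose D : ℝ) ≤ (2 * (max 1 m : ℕ)) ^ D := by
    have : ((m + D).choose D : ℝ) ≤ ((m + 1 : ℕ) : ℝ) ^ D := by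
      exact_mod_cast choose_add_self_le m D
    refine this.trans (pow_le_pow_left₀ (by positivity) ?_ _)
    have : m + 1 ≤ 2 * max 1 m := by omega
    exact_mod_cast this
  have e3 : √((m + D).choose D * (n + D).choose D) * x ^ D ≤
      (1 + x / 8) ^ (n + D) * √((5 * (max 1 m : ℕ) * α) ^ D) := by
    have : √((m + D).choose D * (n + D).choose D) * x ^ D =
        √((m + D).choose D * (n + D).choose D * (x ^ D) ^ 2) := by
      rw [Real.sqrt_mul (x := (m + D).choose D * (n + D).choose D) (by positivity),
        Real.sqrt_sq (by positivity)]
    rw [this]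
    refine Real.sqrt_le_iff.mpr ⟨by positivity, ?_⟩
    rw [mul_pow, Real.sq_sqrt (by positivity)]
    calc ((m + D).choose D : ℝ) * (n + D).choose D * (x ^ D) ^ 2
        = ((n + D).choose D * (x / 4) ^ D) * ((m + D).choose D * (4 * x) ^ D) := by
          rw [div_pow, mul_pow]; field_simp
      _ ≤ (1 + x / 4) ^ (n + D) * ((2 * (max 1 m : ℕ)) ^ D * (4 * x) ^ D) := by gcongr
      _ ≤ ((1 + x / 8) ^ (n + D)) ^ 2 * (5 * (max 1 m : ℕ) * α) ^ D := by
          rw [← pow_mul, mul_comm (n + D) 2, pow_mul (1 + x / 8), ← mul_pow (2 * ((max 1 m : ℕ) : ℝ))]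
          have : (2 * ((max 1 m : ℕ) : ℝ)) * (4 * x) ≤ 5 * (max 1 m : ℕ) * α := by
            have : (0 : ℝ) ≤ (max 1 m : ℕ) := by positivity
            nlinarith
          gcongr
          nlinarith
  calc r ^ (m + n + D) * ((1 + x) ^ (m + n) * (√((m + D).choose D * (n + D).choose D) * x ^ D))
      ≤ r ^ (m + n + D) * ((1 + x) ^ (m + n + D) * ((1 + x / 8) ^ (m + n + D) *
          √((5 * (max 1 m : ℕ) * α) ^ D))) := by
        have f1 : (1 + x) ^ (m + n) ≤ (1 + x) ^ (m + n + D) :=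
          pow_le_pow_right₀ (by linarith) (by omega)
        have f2 : (1 + x / 8) ^ (n + D) ≤ (1 + x / 8) ^ (m + n + D) :=
          pow_le_pow_right₀ (by linarith) (by omega)
        have f3 := e3.trans (mul_le_mul_of_nonneg_right f2 (Real.sqrt_nonneg _))
        refine mul_le_mul_of_nonneg_left ?_ (by positivity)
        exact mul_le_mul f1 f3 (by positivity) (by positivity)
    _ = (r * (1 + x) * (1 + x / 8)) ^ (m + n + D) * √((5 * (max 1 m : ℕ) * α) ^ D) := by
        rw [mul_pow (r * (1 + x)), mul_pow r]
        simp only [mul_assoc]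
    _ ≤ _ := by
        rw [mul_comm _ ((m + n + D : ℕ) : ℝ), Real.exp_nat_mul]
        gcongr
        calc r * (1 + x) * (1 + x / 8)
            ≤ Real.exp (-(4 / 9 * Ω * α)) * Real.exp (x / 8) := by
              gcongr
              linarith [Real.add_one_le_exp (x / 8)]
          _ ≤ _ := by
              rw [← Real.exp_add]
              refine Real.exp_le_exp.mpr ?_
              -- The spare decay suffices: `x/8 ≤ 5α/64`, while `(4/9 - 1/4)Ωα ≥ 7α/72` for `Ω ≥
              -- 1/2`.
              nlinarith [mul_le_mul_of_nonneg_right hΩ.1 hα]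

theorem sqrt_pow_eq_rpow {x : ℝ} (hx : 0 ≤ x) (D : ℕ) : √(x ^ D) = x ^ ((D : ℝ) / 2) := by
  rw [Real.sqrt_eq_rpow, ← Real.rpow_natCast, ← Real.rpow_mul hx]
  congr 1; ring

theorem kernel_le_min (hΩ : Ω ∈ Set.Icc (1 / 2 : ℝ) 1) (hα : 0 ≤ α) (hα1 : α ≤ 1)
    {m n k l : ℕ} (h : m + k = n + l) :
    kernel Ω α m n k l ≤ Real.exp (-(1 / 4 * Ω * α) * (m + k : ℕ)) *
      min 1 ((5 * (max 1 (min (min m l) (min n k)) : ℕ) * α) ^ (|(m : ℝ) - l| / 2)) := by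
  have hΩ0 : 0 < Ω := by linarith [hΩ.1]
  have h1 : kernel Ω α m n k l ≤ Real.exp (-(1 / 4 * Ω * α) * (m + k : ℕ)) := by
    refine (kernel_le_exp hΩ hα hα1 h).trans (Real.exp_le_exp.mpr ?_)
    have : 0 ≤ Ω * α * (m + k : ℕ) := by positivity
    nlinarith
  have hmax : (1 : ℝ) ≤ (max 1 (min (min m l) (min n k)) : ℕ) := by
    exact_mod_cast le_max_left _ _
  rcases le_total α (1 / 2) with hα2 | hα2
  · rw [mul_min_of_nonneg _ _ (Real.exp_nonneg _), mul_one]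
    refine le_min h1 ?_
    have main : ∀ m n D : ℕ, kernel Ω α m n (n + D) (m + D) ≤
        Real.exp (-(1 / 4 * Ω * α) * (m + n + D : ℕ)) *
          (5 * (max 1 (min m n) : ℕ) * α) ^ ((D : ℝ) / 2) := by
      intro m n D
      rw [← sqrt_pow_eq_rpow (by positivity)]
      rcases le_total m n with hmn | hmn
      · rw [min_eq_left hmn]
        exact kernel_add_le_min hΩ hα hα2 _ _ D
      · rw [min_eq_right hmn, kernel_transpose, add_comm m n]
        exact kernel_add_le_min hΩ hα hα2 _ _ D
    rcases le_total m l with hml | hml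
    · obtain ⟨D, rfl⟩ := Nat.exists_eq_add_of_le hml
      obtain rfl : k = n + D := by omega
      have e1 : |(m : ℝ) - ((m + D : ℕ) : ℝ)| = D := by
        push_cast
        rw [sub_add_cancel_left, abs_neg, abs_of_nonneg (by positivity)]
      have e2 : min (min m (m + D)) (min n (n + D)) = min m n := by omega
      rw [e1, e2, ← add_assoc]
      exact main m n D
    · obtain ⟨D, rfl⟩ := Nat.exists_eq_add_of_le hml
      obtain rfl : n = k + D := by omega
      have e1 : |((l + D : ℕ) : ℝ) - (l : ℝ)| = D := by
        push_cast
        rw [add_sub_cancel_left, abs_of_nonneg (by positivity)]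
      have e2 : min (min (l + D) l) (min (k + D) k) = min l k := by omega
      rw [e1, e2, kernel_swap Ω α h, show l + D + k = l + k + D by ring]
      exact main l k D
  · have : 1 ≤ (5 * (max 1 (min (min m l) (min n k)) : ℕ) * α) ^ (|(m : ℝ) - l| / 2) :=
      Real.one_le_rpow (by nlinarith) (by positivity)
    rwa [min_eq_left this, mul_one]

end bounds

/-! ### From the kernel to the slices -/

section slices

variable {θ μ₀ Ω M : ℝ} {i : ℕ}

theorem zpow_slice_pos (hM : 2 ≤ M) : 0 < M ^ (-2 * (i : ℤ)) := zpow_pos (by linarith) _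

theorem zpow_slice_upper (hM : 2 ≤ M) :
    M ^ (-2 * ((i : ℤ) - 1)) = M ^ 2 * M ^ (-2 * (i : ℤ)) := by
  rw [show -2 * ((i : ℤ) - 1) = 2 + -2 * (i : ℤ) by ring, zpow_add₀ (by linarith)]
  norm_cast

theorem zpow_slice_lower_le (hM : 2 ≤ M) :
    M ^ (-2 * (i : ℤ)) ≤ M ^ (-2 * ((i : ℤ) - 1)) :=
  zpow_le_zpow_right₀ (by linarith) (by linarith)

theorem zpow_slice_upper_le_one (hM : 2 ≤ M) (hi : 1 ≤ i) :
    M ^ (-2 * ((i : ℤ) - 1)) ≤ 1 :=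
  zpow_le_one_of_nonpos₀ (by linarith) (by have : (1 : ℤ) ≤ i := by exact_mod_cast hi
                                           linarith)

theorem slice_nonneg (hθ : 0 < θ) (hM : 2 ≤ M) (hi : 1 ≤ i) (hΩ : Ω ∈ Set.Icc (1 / 2 : ℝ) 1)
    (m n k l : Idx) : 0 ≤ slice θ μ₀ Ω M i m n k l := by
  have hΩ0 : 0 < Ω := by linarith [hΩ.1]
  have hC := constC_nonneg hΩ0
  unfold slice
  split_ifs
  · refine mul_nonneg (by positivity) ?_
    refine intervalIntegral.integral_nonneg (zpow_slice_lower_le hM) fun α hα => ?_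
    have h0 : 0 ≤ α := (zpow_slice_pos hM).le.trans hα.1
    have h1 : 0 ≤ 1 - α := by linarith [hα.2.trans (zpow_slice_upper_le_one hM hi)]
    exact mul_nonneg (by positivity)
      (Finset.prod_nonneg fun s _ => kernel_nonneg hΩ0 hΩ.2 h0 _ _ _ _)
  · exact le_rfl

theorem slice_le (hθ : 0 < θ) (hM : 2 ≤ M) (hi : 1 ≤ i) (hΩ : Ω ∈ Set.Icc (1 / 2 : ℝ) 1)
    (m n k l : Idx) {b : Fin 2 → ℝ} (hb : ∀ s, 0 ≤ b s)
    (h : m + k = n + l → ∀ α, M ^ (-2 * (i : ℤ)) ≤ α → α ≤ M ^ 2 * M ^ (-2 * (i : ℤ)) → α ≤ 1 →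
      ∀ s, kernel Ω α (m s) (n s) (k s) (l s) ≤ b s) :
    slice θ μ₀ Ω M i m n k l ≤ θ * M ^ 2 / 4 * M ^ (-2 * (i : ℤ)) * ∏ s, b s := by
  have hΩ0 : 0 < Ω := by linarith [hΩ.1]
  have hC := constC_nonneg hΩ0
  have hτ := zpow_slice_pos (i := i) hM
  have hle := zpow_slice_lower_le (i := i) hM
  have hprod : 0 ≤ ∏ s, b s := Finset.prod_nonneg fun s _ => hb s
  unfold slice
  split_ifs with hmk
  · have key : ‖∫ α in (M ^ (-2 * (i : ℤ)))..(M ^ (-2 * ((i : ℤ) - 1))),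
        (1 - α) ^ (μ₀ ^ 2 * θ / (8 * Ω)) / (1 + constC Ω * α) ^ 2 *
          ∏ s, kernel Ω α (m s) (n s) (k s) (l s)‖ ≤
        (∏ s, b s) * |M ^ (-2 * ((i : ℤ) - 1)) - M ^ (-2 * (i : ℤ))| := by
      refine intervalIntegral.norm_integral_le_of_norm_le_const fun α hα => ?_
      rw [Set.uIoc_of_le hle] at hα
      have h0 : 0 ≤ α := hτ.le.trans hα.1.le
      have h1 : α ≤ 1 := hα.2.trans (zpow_slice_upper_le_one hM hi)
      have hker : ∀ s, 0 ≤ kernel Ω α (m s) (n s) (k s) (l s) :=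
        fun s => kernel_nonneg hΩ0 hΩ.2 h0 _ _ _ _
      have hker2 := h hmk α hα.1.le (hα.2.trans_eq (zpow_slice_upper hM)) h1
      have e1 : (1 - α) ^ (μ₀ ^ 2 * θ / (8 * Ω)) / (1 + constC Ω * α) ^ 2 ≤ 1 := by
        rw [div_le_one (by positivity)]
        refine (Real.rpow_le_one (by linarith) (by linarith) (by positivity)).trans ?_
        exact one_le_pow₀ (by nlinarith)
      have e2 : 0 ≤ (1 - α) ^ (μ₀ ^ 2 * θ / (8 * Ω)) / (1 + constC Ω * α) ^ 2 := by
        have : 0 ≤ 1 - α := by linarith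
        positivity
      have e3 : ∏ s, kernel Ω α (m s) (n s) (k s) (l s) ≤ ∏ s, b s :=
        Finset.prod_le_prod (fun s _ => hker s) fun s _ => hker2 s
      have e4 : 0 ≤ ∏ s, kernel Ω α (m s) (n s) (k s) (l s) :=
        Finset.prod_nonneg fun s _ => hker s
      rw [Real.norm_of_nonneg (mul_nonneg e2 e4)]
      nlinarith
    rw [abs_of_nonneg (sub_nonneg.2 hle)] at key
    -- This is where `Ω ≥ 1/2` makes the constant uniform in `Ω`.
    have e5 : θ / (8 * Ω) ≤ θ / 4 := by
      gcongr
      linarith [hΩ.1]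
    calc _ ≤ θ / 4 * ((∏ s, b s) * (M ^ (-2 * ((i : ℤ) - 1)) - M ^ (-2 * (i : ℤ)))) := by
          refine (mul_le_mul_of_nonneg_left ((Real.le_norm_self _).trans key)
            (by positivity)).trans (mul_le_mul_of_nonneg_right e5 ?_)
          exact (norm_nonneg _).trans key
      _ ≤ θ / 4 * ((∏ s, b s) * (M ^ 2 * M ^ (-2 * (i : ℤ)))) := by
          rw [← zpow_slice_upper hM]
          gcongr
          linarith
      _ = _ := by ring
  · positivity

theorem exp_neg_mul_le {c : ℝ} (hc : 0 ≤ c) {τ α : ℝ} (h : τ ≤ α) (N : ℕ) :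
    Real.exp (-(c * α) * N) ≤ Real.exp (-(c * τ) * N) := by
  refine Real.exp_le_exp.mpr ?_
  have : c * τ * N ≤ c * α * N := by gcongr
  linarith

theorem prod_exp_eq_norm1 (c : ℝ) (f : Fin 2 → ℕ) (v : Fin 2 → ℤ) (h : ∀ s, (f s : ℤ) = v s) :
    ∏ s, Real.exp (-c * f s) = Real.exp (-c * norm1 v) := by
  rw [← Real.exp_sum, ← Finset.mul_sum]
  congr 2
  refine Finset.sum_congr rfl fun s _ => ?_
  rw [← h s]
  simp

theorem slice_le_exp (hθ : 0 < θ) (hM : 2 ≤ M) (hi : 1 ≤ i) (hΩ : Ω ∈ Set.Icc (1 / 2 : ℝ) 1)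
    (m n k l : Idx) :
    slice θ μ₀ Ω M i m n k l ≤ θ * M ^ 2 / 4 * M ^ (-2 * (i : ℤ)) *
      ∏ s, Real.exp (-(Ω / 3 * M ^ (-2 * (i : ℤ))) * (m s + k s : ℕ)) := by
  have hΩ0 : 0 < Ω := by linarith [hΩ.1]
  have hτ := zpow_slice_pos (i := i) hM
  refine slice_le hθ hM hi hΩ m n k l (fun s => (Real.exp_pos _).le) ?_
  intro h α h1 _ h3 s
  have h0 : 0 ≤ α := hτ.le.trans h1
  refine (kernel_le_exp hΩ h0 h3 (congrFun h s)).trans ?_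
  refine le_trans ?_ (exp_neg_mul_le (by positivity) h1 _)
  refine Real.exp_le_exp.mpr ?_
  have : 0 ≤ Ω * α * (m s + k s : ℕ) := by positivity
  linarith

theorem slice_le_min (hθ : 0 < θ) (hM : 2 ≤ M) (hi : 1 ≤ i) (hΩ : Ω ∈ Set.Icc (1 / 2 : ℝ) 1)
    (m n k l : Idx) :
    slice θ μ₀ Ω M i m n k l ≤ θ * M ^ 2 / 4 * M ^ (-2 * (i : ℤ)) *
      ∏ s, (Real.exp (-(Ω / 4 * M ^ (-2 * (i : ℤ))) * (m s + k s : ℕ)) *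
        min 1 ((5 * M ^ 2 * (max 1 (min (min (m s) (l s)) (min (n s) (k s))) : ℕ) /
          M ^ (2 * i)) ^ (|(m s : ℝ) - (l s : ℝ)| / 2))) := by
  have hΩ0 : 0 < Ω := by linarith [hΩ.1]
  have hτ := zpow_slice_pos (i := i) hM
  have hM0 : 0 < M := by linarith
  refine slice_le hθ hM hi hΩ m n k l (fun s => by positivity) ?_
  intro h α h1 h2 h3 s
  have h0 : 0 ≤ α := hτ.le.trans h1
  refine (kernel_le_min hΩ h0 h3 (congrFun h s)).trans ?_
  have e : M ^ (-2 * (i : ℤ)) = (M ^ (2 * i))⁻¹ := by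
    rw [neg_mul, zpow_neg]; norm_cast
  have e1 : Real.exp (-(1 / 4 * Ω * α) * (m s + k s : ℕ)) ≤
      Real.exp (-(Ω / 4 * M ^ (-2 * (i : ℤ))) * (m s + k s : ℕ)) := by
    rw [show 1 / 4 * Ω = Ω / 4 by ring]
    exact exp_neg_mul_le (by positivity) h1 _
  refine mul_le_mul e1 (min_le_min le_rfl ?_) (by positivity) (Real.exp_pos _).le
  refine Real.rpow_le_rpow (by positivity) ?_ (by positivity)
  rw [e] at h2
  calc _ ≤ 5 * ((max 1 (min (min (m s) (l s)) (min (n s) (k s))) : ℕ) : ℝ) *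
        (M ^ 2 * (M ^ (2 * i))⁻¹) := by gcongr
    _ = _ := by rw [div_eq_mul_inv]; ring

/-! ### Sums over the index jump -/

/-- Geometric weight of an index jump in `ℤ²`. -/
noncomputable def jumpWeight (v : Fin 2 → ℤ) : ℝ := ∏ s, (2 / 3 : ℝ) ^ (v s).natAbs

theorem jumpWeight_nonneg (v : Fin 2 → ℤ) : 0 ≤ jumpWeight v :=
  Finset.prod_nonneg fun _ _ => by positivity

theorem summable_jumpWeight : Summable jumpWeight := by
  have h1 : Summable fun z : ℤ => (2 / 3 : ℝ) ^ z.natAbs := by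
    refine Summable.of_nat_of_neg ?_ ?_ <;>
    · simpa using summable_geometric_of_lt_one (by norm_num : (0 : ℝ) ≤ 2 / 3) (by norm_num)
  have h2 := h1.mul_of_nonneg h1 (fun _ => by positivity) (fun _ => by positivity)
  rw [← (finTwoArrowEquiv ℤ).summable_iff] at h2
  refine h2.congr fun v => ?_
  simp [jumpWeight, Fin.prod_univ_two, finTwoArrowEquiv]

theorem tsum_jumpWeight_pos : 0 < ∑' v, jumpWeight v :=
  summable_jumpWeight.tsum_pos jumpWeight_nonneg 0 (by simp [jumpWeight])

theorem slice_le_jump (hθ : 0 < θ) (hM : 2 ≤ M) (hi : 1 ≤ i) (hΩ : Ω ∈ Set.Icc (2 / 3 : ℝ) 1)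
    (m n k l : Idx) :
    slice θ μ₀ Ω M i m n k l ≤ θ * M ^ 2 / 4 * M ^ (-2 * (i : ℤ)) *
      (Real.exp (-(Ω / 4 * M ^ (-2 * (i : ℤ))) * norm1 (fun s => m s + k s)) *
        jumpWeight (fun s => l s - m s)) := by
  have hΩ0 : 0 < Ω := by linarith [hΩ.1]
  have hτ := zpow_slice_pos (i := i) hM
  have := slice_le (μ₀ := μ₀) hθ hM hi (Ω := Ω) ⟨by linarith [hΩ.1], hΩ.2⟩ m n k l
    (b := fun s => Real.exp (-(Ω / 4 * M ^ (-2 * (i : ℤ))) * (m s + k s : ℕ)) *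
      (2 / 3) ^ ((l s : ℤ) - m s).natAbs) (fun s => by positivity) ?_
  · rwa [Finset.prod_mul_distrib, prod_exp_eq_norm1 _ _ (fun s => (m s : ℤ) + k s)
      (fun s => by push_cast; rfl)] at this
  intro h α h1 _ h3 s
  have h0 : 0 ≤ α := hτ.le.trans h1
  refine (kernel_le_jump hΩ h0 h3 (congrFun h s)).trans ?_
  rw [show ((l s : ℤ) - m s).natAbs = ((m s : ℤ) - l s).natAbs by omega,
    show 1 / 4 * Ω = Ω / 4 by ring]
  exact mul_le_mul_of_nonneg_right (exp_neg_mul_le (by positivity) h1 _) (by positivity)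

theorem norm1_nonneg (v : Fin 2 → ℤ) : 0 ≤ norm1 v := Finset.sum_nonneg fun _ _ => abs_nonneg _

theorem norm1_add_natCast (a b : Idx) :
    norm1 (fun s => (a s : ℤ) + b s) = norm1 (fun s => (a s : ℤ)) + norm1 (fun s => (b s : ℤ)) := by
  unfold norm1
  rw [← Finset.sum_add_distrib]
  refine Finset.sum_congr rfl fun s _ => ?_
  push_cast
  rw [abs_of_nonneg, abs_of_nonneg, abs_of_nonneg] <;> positivity

theorem toIdx_sub_eq {m : Idx} {l : Fin 2 → ℤ} (h : ∀ s, -(m s : ℤ) ≤ l s) :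
    (fun s => (toIdx (fun s => (m s : ℤ) + l s) s : ℤ) - m s) = l := by
  funext s
  have := h s
  simp only [toIdx]
  omega

theorem slice_jump_le (hθ : 0 < θ) (hM : 2 ≤ M) (hi : 1 ≤ i) (hΩ : Ω ∈ Set.Icc (2 / 3 : ℝ) 1)
    (m n p : Idx) {l : Fin 2 → ℤ} (hl : ∀ s, -(m s : ℤ) ≤ l s) :
    slice θ μ₀ Ω M i m n p (toIdx (fun s => m s + l s)) ≤
      θ * M ^ 2 / 4 * M ^ (-2 * (i : ℤ)) *
        Real.exp (-(Ω / 4) * M ^ (-2 * (i : ℤ)) *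
          (norm1 (fun s => p s) + norm1 (fun s => m s))) * jumpWeight l := by
  refine (slice_le_jump hθ hM hi hΩ m n p _).trans_eq ?_
  rw [toIdx_sub_eq hl, norm1_add_natCast, add_comm (norm1 fun s => (p s : ℤ)), neg_mul (Ω / 4)]
  ring

theorem sum_slice_jump_le (hθ : 0 < θ) (hM : 2 ≤ M) (hi : 1 ≤ i)
    (hΩ : Ω ∈ Set.Icc (2 / 3 : ℝ) 1) (m p : Idx) :
    ∑ l ∈ Finset.Icc (fun s => -(m s : ℤ)) (fun s => (p s : ℤ)),
        slice θ μ₀ Ω M i m (toIdx (fun s => p s - l s)) p (toIdx (fun s => m s + l s)) ≤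
      (θ * M ^ 2 / 4 * ∑' v, jumpWeight v) * M ^ (-2 * (i : ℤ)) *
        Real.exp (-(Ω / 4) * M ^ (-2 * (i : ℤ)) *
          (norm1 (fun s => p s) + norm1 (fun s => m s))) := by
  have hτ := zpow_slice_pos (i := i) hM
  have h1 := Finset.sum_le_sum (s := Finset.Icc (fun s => -(m s : ℤ)) (fun s => (p s : ℤ)))
    fun l hl => slice_jump_le (μ₀ := μ₀) hθ hM hi hΩ m (toIdx (fun s => p s - l s)) p
      (fun s => (Finset.mem_Icc.mp hl).1 s)
  refine h1.trans ?_
  rw [← Finset.mul_sum]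
  refine (mul_le_mul_of_nonneg_left
    (summable_jumpWeight.sum_le_tsum _ fun v _ => jumpWeight_nonneg v) (by positivity)).trans_eq ?_
  ring

/-- If `f q > 0` for some `q` in `S`, exponential decay makes the set of points of `S` with `f ≥ f
q` finite, so a maximum exists there. Otherwise `f` vanishes on `S`. -/
theorem exists_isGreatest_image_of_le_exp {f : Idx → ℝ} {S : Set Idx} (hS : S.Nonempty)
    (hf : ∀ p, 0 ≤ f p) {B c : ℝ} (hc : 0 < c)
    (hB : ∀ p, f p ≤ B * Real.exp (-c * norm1 (fun s => p s))) :
    ∃ y, IsGreatest (f '' S) y := by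
  by_cases h : ∃ q ∈ S, 0 < f q
  · obtain ⟨q, hq, hq0⟩ := h
    have hB0 : 0 < B := by
      by_contra hneg
      have := hB q
      nlinarith [Real.exp_pos (-c * norm1 (fun s => (q s : ℤ)))]
    have hfin : {p | p ∈ S ∧ f q ≤ f p}.Finite := by
      refine (Set.finite_Icc (0 : Idx) (fun _ => ⌈B / (c * f q)⌉₊)).subset ?_
      rintro p ⟨_, hp⟩
      refine ⟨fun _ => Nat.zero_le _, fun s => ?_⟩
      have e1 : f q ≤ B * Real.exp (-c * norm1 (fun s => (p s : ℤ))) := hp.trans (hB p)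
      set N := norm1 (fun s => (p s : ℤ)) with hN
      have e2 : f q * (c * N) ≤ B := by
        have e3 : c * N ≤ Real.exp (c * N) := by linarith [Real.add_one_le_exp (c * N)]
        calc f q * (c * N) ≤ f q * Real.exp (c * N) := by gcongr
          _ ≤ B * Real.exp (-c * N) * Real.exp (c * N) := by gcongr
          _ = B := by rw [mul_assoc, ← Real.exp_add]; simp
      have e4 : (p s : ℝ) ≤ N := by
        have := Finset.single_le_sum (f := fun s => |((p s : ℤ) : ℝ)|)
          (fun _ _ => abs_nonneg _) (Finset.mem_univ s)
        rw [hN, norm1]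
        simpa using this
      have e5 : (p s : ℝ) ≤ B / (c * f q) := by
        rw [le_div_iff₀ (by positivity)]
        nlinarith [mul_pos hc hq0]
      exact_mod_cast e5.trans (Nat.le_ceil _)
    obtain ⟨a, ha, hmax⟩ := Set.exists_max_image _ f hfin ⟨q, hq, le_rfl⟩
    refine ⟨f a, ⟨a, ha.1, rfl⟩, ?_⟩
    rintro _ ⟨b, hb, rfl⟩
    rcases le_total (f q) (f b) with h1 | h1
    · exact hmax b ⟨hb, h1⟩
    · exact h1.trans ha.2
  · push Not at h
    obtain ⟨q, hq⟩ := hS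
    refine ⟨f q, ⟨q, hq, rfl⟩, ?_⟩
    rintro _ ⟨b, hb, rfl⟩
    exact (h b hb).trans (hf q)

theorem exists_jump_maxima (hθ : 0 < θ) (hM : 2 ≤ M) (hi : 1 ≤ i)
    (hΩ : Ω ∈ Set.Icc (2 / 3 : ℝ) 1) (m : Idx) :
    ∃ g : Set.Ici (fun s => -(m s : ℤ)) → ℝ,
      (∀ l, IsGreatest
        ((fun p : Idx => slice θ μ₀ Ω M i m (toIdx (fun s => p s - l.1 s)) p
            (toIdx (fun s => m s + l.1 s))) '' {p | ∀ s, max (l.1 s) 0 ≤ (p s : ℤ)}) (g l)) ∧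
      Summable g ∧
      ∑' l, g l ≤ (θ * M ^ 2 / 4 * ∑' v, jumpWeight v) * M ^ (-2 * (i : ℤ)) *
        Real.exp (-(Ω / 36) * M ^ (-2 * (i : ℤ)) * norm1 (fun s => m s)) := by
  have hτ := zpow_slice_pos (i := i) hM
  have hΩ0 : 0 < Ω := by linarith [hΩ.1]
  have hΩ' : Ω ∈ Set.Icc (1 / 2 : ℝ) 1 := ⟨by linarith [hΩ.1], hΩ.2⟩
  have hex : ∀ l : Set.Ici (fun s => -(m s : ℤ)), ∃ y, IsGreatest
      ((fun p : Idx => slice θ μ₀ Ω M i m (toIdx (fun s => p s - l.1 s)) p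
        (toIdx (fun s => m s + l.1 s))) '' {p | ∀ s, max (l.1 s) 0 ≤ (p s : ℤ)}) y := by
    intro l
    refine exists_isGreatest_image_of_le_exp (c := Ω / 4 * M ^ (-2 * (i : ℤ)))
      (B := θ * M ^ 2 / 4 * M ^ (-2 * (i : ℤ)) * Real.exp (-(Ω / 4) * M ^ (-2 * (i : ℤ)) *
          norm1 (fun s => m s)) * jumpWeight l.1)
      ⟨toIdx l.1, fun s => by simp only [toIdx]; omega⟩
      (fun p => slice_nonneg hθ hM hi hΩ' _ _ _ _) (by positivity) fun p => ?_
    refine (slice_jump_le hθ hM hi hΩ m _ p (fun s => l.2 s)).trans_eq ?_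
    rw [mul_add, Real.exp_add, neg_mul (Ω / 4)]
    ring
  choose g hg using hex
  have hg0 : ∀ l, 0 ≤ g l := by
    intro l
    obtain ⟨p, _, hp⟩ := (hg l).1
    rw [← hp]
    exact slice_nonneg hθ hM hi hΩ' _ _ _ _
  have hgle : ∀ l, g l ≤ θ * M ^ 2 / 4 * M ^ (-2 * (i : ℤ)) *
      Real.exp (-(Ω / 36) * M ^ (-2 * (i : ℤ)) * norm1 (fun s => m s)) * jumpWeight l.1 := by
    intro l
    obtain ⟨p, _, hp⟩ := (hg l).1
    rw [← hp]
    refine (slice_jump_le hθ hM hi hΩ m _ p (fun s => l.2 s)).trans ?_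
    refine mul_le_mul_of_nonneg_right (mul_le_mul_of_nonneg_left (Real.exp_le_exp.mpr ?_)
      (by positivity)) (jumpWeight_nonneg _)
    -- The decay in `p` is dropped and the rate `1/4` in `m` is weakened to `1/36`.
    have h1 := mul_nonneg (mul_pos hΩ0 hτ).le (norm1_nonneg (fun s => (p s : ℤ)))
    have h2 := mul_nonneg (mul_pos hΩ0 hτ).le (norm1_nonneg (fun s => (m s : ℤ)))
    linarith
  have hsum := summable_jumpWeight.subtype (Set.Ici (fun s => -(m s : ℤ)))
  have hsum' := hsum.mul_left (θ * M ^ 2 / 4 * M ^ (-2 * (i : ℤ)) *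
    Real.exp (-(Ω / 36) * M ^ (-2 * (i : ℤ)) * norm1 (fun s => m s)))
  have hgs : Summable g := Summable.of_nonneg_of_le hg0 hgle hsum'
  refine ⟨g, hg, hgs, (hgs.tsum_le_tsum hgle hsum').trans ?_⟩
  rw [tsum_mul_left]
  refine (mul_le_mul_of_nonneg_left
    (summable_jumpWeight.tsum_subtype_le jumpWeight _ jumpWeight_nonneg)
    (by positivity)).trans_eq ?_
  ring

/-! ### Scaling exponents -/

theorem kernel_zero (α : ℝ) : kernel Ω α 0 0 0 0 = 1 := by
  simp [kernel, combA]

/-- Taking `i ≥ 2` keeps `α ≤ 1/4`, away from `α = 1` where the mass factor may vanish. The interval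
has length `(M² - 1) M^(-2i) ≥ M^(-2i)`. -/
theorem slice_zero_ge (hθ : 0 < θ) (hM : 2 ≤ M) (hi : 2 ≤ i) (hΩ : Ω ∈ Set.Icc (1 / 2 : ℝ) 1) :
    θ / (8 * Ω) * ((3 / 4) ^ (μ₀ ^ 2 * θ / (8 * Ω)) / (1 + constC Ω) ^ 2) * M ^ (-2 * (i : ℤ)) ≤
      slice θ μ₀ Ω M i 0 0 0 0 := by
  have hΩ0 : 0 < Ω := by linarith [hΩ.1]
  have hC := constC_nonneg hΩ0
  have hτ := zpow_slice_pos (i := i) hM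
  have hle := zpow_slice_lower_le (i := i) hM
  have hupper : M ^ (-2 * ((i : ℤ) - 1)) ≤ 1 / 4 := by
    calc M ^ (-2 * ((i : ℤ) - 1)) ≤ M ^ (-2 : ℤ) := by
          refine zpow_le_zpow_right₀ (by linarith) ?_
          have : (2 : ℤ) ≤ i := by exact_mod_cast hi
          linarith
      _ = (M ^ 2)⁻¹ := by rw [zpow_neg]; norm_cast
      _ ≤ 1 / 4 := by
          rw [one_div]
          exact inv_anti₀ (by norm_num) (by nlinarith)
  unfold slice
  simp only [if_true, Pi.zero_apply, kernel_zero, Finset.prod_const_one, mul_one]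
  rw [mul_assoc]
  refine mul_le_mul_of_nonneg_left ?_ (by positivity)
  set w : ℝ := (3 / 4) ^ (μ₀ ^ 2 * θ / (8 * Ω)) / (1 + constC Ω) ^ 2 with hw
  have hw0 : 0 ≤ w := by positivity
  calc w * M ^ (-2 * (i : ℤ))
      ≤ ∫ _ in (M ^ (-2 * (i : ℤ)))..(M ^ (-2 * ((i : ℤ) - 1))), w := by
        rw [intervalIntegral.integral_const, smul_eq_mul, zpow_slice_upper hM, mul_comm]
        refine mul_le_mul_of_nonneg_right ?_ hw0
        nlinarith [mul_le_mul_of_nonneg_right (show (2 : ℝ) ≤ M ^ 2 by nlinarith) hτ.le]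
    _ ≤ _ := by
        refine intervalIntegral.integral_mono_on hle intervalIntegrable_const ?_ ?_
        · refine ContinuousOn.intervalIntegrable fun α hα => ?_
          rw [Set.uIcc_of_le hle] at hα
          have h0 : 0 ≤ α := hτ.le.trans hα.1
          refine ContinuousAt.continuousWithinAt ?_
          refine ContinuousAt.div ?_ (by fun_prop) (by positivity)
          exact ContinuousAt.rpow_const (by fun_prop) (Or.inr (by positivity))
        · intro α hα
          have h0 : 0 ≤ α := hτ.le.trans hα.1
          have h1 : α ≤ 1 / 4 := hα.2.trans hupper
          have h2 : (0 : ℝ) ≤ 1 - α := by linarith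
          rw [hw]
          refine div_le_div₀ (by positivity) ?_ (by positivity) ?_
          · exact Real.rpow_le_rpow (by norm_num) (by linarith) (by positivity)
          · exact pow_le_pow_left₀ (by positivity) (by nlinarith) _

theorem zpow_slice_eq_rpow :
    M ^ (-2 * (i : ℤ)) = M ^ (-((i : ℝ) * 2)) := by
  rw [← Real.rpow_intCast]
  congr 1
  push_cast
  ring

/-- If `δ > 2`, then `c ≤ C (M^(2-δ))^i` for all large `i`, and the right side tends to 0,
contradicting `c > 0`. -/
theorem exponent_le_two {δ c C : ℝ} (hM : 2 ≤ M) (hc : 0 < c)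
    (h : ∀ i : ℕ, 2 ≤ i → c * M ^ (-2 * (i : ℤ)) ≤ C * M ^ (-((i : ℝ) * δ))) : δ ≤ 2 := by
  by_contra hδ
  push Not at hδ
  have hM0 : 0 < M := by linarith
  have hq : M ^ (2 - δ) < 1 := Real.rpow_lt_one_of_one_lt_of_neg (by linarith) (by linarith)
  have hlim : Filter.Tendsto (fun i : ℕ => C * (M ^ (2 - δ)) ^ i) Filter.atTop (nhds (C * 0)) :=
    (tendsto_pow_atTop_nhds_zero_of_lt_one (by positivity) hq).const_mul C
  have hle : ∀ᶠ i : ℕ in Filter.atTop, c ≤ C * (M ^ (2 - δ)) ^ i := by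
    filter_upwards [Filter.eventually_ge_atTop 2] with i hi
    have h1 := h i hi
    rw [zpow_slice_eq_rpow, ← le_div_iff₀ (by positivity), mul_div_assoc,
      ← Real.rpow_sub hM0] at h1
    rw [← Real.rpow_natCast, ← Real.rpow_mul hM0.le]
    rwa [show (2 - δ) * (i : ℝ) = -((i : ℝ) * δ) - -((i : ℝ) * 2) by ring]
  have := ge_of_tendsto hlim hle
  linarith

theorem hasDelta0_slice (hθ : 0 < θ) (hM : 2 ≤ M) (hΩ : Ω ∈ Set.Icc (1 / 2 : ℝ) 1) :
    HasDelta0 M (slice θ μ₀ Ω M) 2 := by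
  have hΩ0 : 0 < Ω := by linarith [hΩ.1]
  have hC := constC_nonneg hΩ0
  constructor
  · refine ⟨θ * M ^ 2 / 4, fun i hi m n k l => ?_⟩
    have hτ := zpow_slice_pos (i := i) hM
    rw [abs_of_nonneg (slice_nonneg hθ hM hi hΩ _ _ _ _)]
    split_ifs with h
    · refine (slice_le_exp hθ hM hi hΩ m n k l).trans ?_
      rw [← zpow_slice_eq_rpow]
      refine mul_le_of_le_one_right (by positivity) ?_
      refine Finset.prod_le_one (fun s _ => (Real.exp_pos _).le) fun s _ => ?_
      rw [neg_mul, Real.exp_le_one_iff, neg_nonpos]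
      positivity
    · simp [slice, h]
  · rintro δ ⟨C, hδ⟩
    refine exponent_le_two (C := C) hM
      (c := θ / (8 * Ω) * ((3 / 4) ^ (μ₀ ^ 2 * θ / (8 * Ω)) / (1 + constC Ω) ^ 2))
      (by positivity) fun i hi => ?_
    have := hδ i (by omega) 0 0 0 0
    rw [if_pos rfl] at this
    exact (slice_zero_ge hθ hM hi hΩ).trans ((le_abs_self _).trans this)

theorem hasDelta1_slice (hθ : 0 < θ) (hM : 2 ≤ M) (hΩ : Ω ∈ Set.Icc (2 / 3 : ℝ) 1) :
    HasDelta1 M (slice θ μ₀ Ω M) 2 := by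
  have hΩ' : Ω ∈ Set.Icc (1 / 2 : ℝ) 1 := ⟨by linarith [hΩ.1], hΩ.2⟩
  have hΩ0 : 0 < Ω := by linarith [hΩ.1]
  have hC := constC_nonneg hΩ0
  constructor
  · refine ⟨θ * M ^ 2 / 4 * ∑' v, jumpWeight v, fun i hi => ?_⟩
    have hτ := zpow_slice_pos (i := i) hM
    rw [← zpow_slice_eq_rpow]
    refine iSup_le fun m => ?_
    set A := θ * M ^ 2 / 4 * M ^ (-2 * (i : ℤ)) with hA
    have hA0 : 0 ≤ A := by positivity
    -- For fixed `m` the sum over `l` becomes part of the sum of `jumpWeight` over all jumps `l -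
    -- m`. The suprema over `n` and `k` cost nothing, since the bound with the exponential dropped
    -- depends on neither.
    have hinj : Function.Injective (fun (l : Idx) (s : Fin 2) => (l s : ℤ) - m s) := by
      intro l l' hll
      funext s
      have := congrFun hll s
      simp only at this
      omega
    calc (∑' l : Idx, ⨆ n : Idx, ⨆ k : Idx, ENNReal.ofReal |slice θ μ₀ Ω M i m n k l|)
        ≤ ∑' l : Idx, ENNReal.ofReal (A * jumpWeight (fun s => (l s : ℤ) - m s)) := by
          refine ENNReal.tsum_le_tsum fun l => iSup_le fun n => iSup_le fun k => ?_
          refine ENNReal.ofReal_le_ofReal ?_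
          rw [abs_of_nonneg (slice_nonneg hθ hM hi hΩ' _ _ _ _)]
          refine (slice_le_jump hθ hM hi hΩ m n k l).trans ?_
          refine mul_le_mul_of_nonneg_left ?_ hA0
          refine mul_le_of_le_one_left (jumpWeight_nonneg _) ?_
          rw [neg_mul, Real.exp_le_one_iff, neg_nonpos]
          exact mul_nonneg (by positivity) (norm1_nonneg _)
      _ ≤ ∑' v : Fin 2 → ℤ, ENNReal.ofReal (A * jumpWeight v) :=
          ENNReal.tsum_comp_le_tsum_of_injective hinj
            (fun v => ENNReal.ofReal (A * jumpWeight v))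
      _ = ENNReal.ofReal (∑' v, A * jumpWeight v) :=
          (ENNReal.ofReal_tsum_of_nonneg (fun v => mul_nonneg hA0 (jumpWeight_nonneg v))
            (summable_jumpWeight.mul_left A)).symm
      _ = _ := by
          rw [tsum_mul_left, hA]
          congr 1
          ring
  · rintro δ ⟨C, hδ⟩
    refine exponent_le_two (C := C) hM
      (c := θ / (8 * Ω) * ((3 / 4) ^ (μ₀ ^ 2 * θ / (8 * Ω)) / (1 + constC Ω) ^ 2))
      (by positivity) fun i hi => ?_
    have hτ := zpow_slice_pos (i := i) hM
    have hge := slice_zero_ge (μ₀ := μ₀) hθ hM hi hΩ'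
    have hpos : 0 < slice θ μ₀ Ω M i 0 0 0 0 := lt_of_lt_of_le (by positivity) hge
    have h1 : ENNReal.ofReal |slice θ μ₀ Ω M i 0 0 0 0| ≤
        ENNReal.ofReal (C * M ^ (-((i : ℝ) * δ))) := by
      refine le_trans ?_ (hδ i (by omega))
      refine le_trans ?_ (le_iSup _ (0 : Idx))
      refine le_trans ?_ (ENNReal.le_tsum (0 : Idx))
      exact le_iSup₂ (f := fun n k : Idx => ENNReal.ofReal |slice θ μ₀ Ω M i 0 n k 0|) 0 0
    rw [abs_of_pos hpos] at h1
    -- The sign of `C` is unknown and `ENNReal.ofReal` truncates at 0; positivity of the slice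
    -- excludes the truncated case.
    exact hge.trans ((ENNReal.ofReal_le_ofReal_iff' .. |>.mp h1).resolve_right (not_le.2 hpos))

end slices

end MatrixPhi4

/-! ### Assembly, with `M₀ = 2` -/

theorem mainTheorem8 (θ μ₀ : ℝ) (hθ : 0 < θ) :
    ∃ M₀ : ℝ, 1 < M₀ ∧ ∀ M : ℝ, M₀ ≤ M →
      -- uniform bound
      (∃ K : ℝ, 0 < K ∧ ∀ Ω ∈ Set.Icc (1 / 2 : ℝ) 1, ∀ i : ℕ, 1 ≤ i →
        ∀ (m n k l : MatrixPhi4.Idx) (h : Fin 2 → ℤ),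
          (∀ s, (n s : ℤ) = m s + h s) → (∀ s, (k s : ℤ) = l s + h s) →
          MatrixPhi4.slice θ μ₀ Ω M i m n k l ≤
            K * M ^ (-2 * (i : ℤ)) *
              Real.exp (-(Ω / 3) * M ^ (-2 * (i : ℤ)) *
                MatrixPhi4.norm1 (fun s => m s + l s + h s))) ∧
      -- refined bound
      (∃ K K₁ : ℝ, 0 < K ∧ 0 < K₁ ∧ ∀ Ω ∈ Set.Icc (1 / 2 : ℝ) 1, ∀ i : ℕ, 1 ≤ i →
        ∀ (m n k l : MatrixPhi4.Idx) (h : Fin 2 → ℤ),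
          (∀ s, (n s : ℤ) = m s + h s) → (∀ s, (k s : ℤ) = l s + h s) →
          MatrixPhi4.slice θ μ₀ Ω M i m n k l ≤
            K * M ^ (-2 * (i : ℤ)) *
              Real.exp (-(Ω / 4) * M ^ (-2 * (i : ℤ)) *
                MatrixPhi4.norm1 (fun s => m s + l s + h s)) *
              ∏ s, min 1
                ((K₁ * (max 1 (min (min (m s) (l s)) (min (n s) (k s))) : ℕ) / M ^ (2 * i)) ^
                  (|(m s : ℝ) - (l s : ℝ)| / 2))) ∧
      -- bound on the sum over the index jump
      (∃ K : ℝ, 0 < K ∧ ∀ Ω ∈ Set.Icc (2 / 3 : ℝ) 1, ∀ i : ℕ, 1 ≤ i →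
        ∀ m p : MatrixPhi4.Idx,
          ∑ l ∈ Finset.Icc (fun s => -(m s : ℤ)) (fun s => (p s : ℤ)),
              MatrixPhi4.slice θ μ₀ Ω M i m (MatrixPhi4.toIdx (fun s => p s - l s)) p
                (MatrixPhi4.toIdx (fun s => m s + l s)) ≤
            K * M ^ (-2 * (i : ℤ)) *
              Real.exp (-(Ω / 4) * M ^ (-2 * (i : ℤ)) *
                (MatrixPhi4.norm1 (fun s => p s) + MatrixPhi4.norm1 (fun s => m s)))) ∧
      -- bound on the sum over the index jump of the maxima
      (∃ K : ℝ, 0 < K ∧ ∀ Ω ∈ Set.Icc (2 / 3 : ℝ) 1, ∀ i : ℕ, 1 ≤ i →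
        ∀ m : MatrixPhi4.Idx, ∃ g : Set.Ici (fun s => -(m s : ℤ)) → ℝ,
          (∀ l, IsGreatest
            ((fun p : MatrixPhi4.Idx =>
                MatrixPhi4.slice θ μ₀ Ω M i m (MatrixPhi4.toIdx (fun s => p s - l.1 s)) p
                  (MatrixPhi4.toIdx (fun s => m s + l.1 s))) ''
              {p | ∀ s, max (l.1 s) 0 ≤ (p s : ℤ)}) (g l)) ∧
          Summable g ∧
          ∑' l, g l ≤
            K * M ^ (-2 * (i : ℤ)) *
              Real.exp (-(Ω / 36) * M ^ (-2 * (i : ℤ)) * MatrixPhi4.norm1 (fun s => m s))) ∧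
      -- scaling exponents and regularity
      (∀ Ω ∈ Set.Icc (1 / 2 : ℝ) 1,
        MatrixPhi4.HasDelta0 M (MatrixPhi4.slice θ μ₀ Ω M) 2) ∧
      (∀ Ω ∈ Set.Icc (2 / 3 : ℝ) 1,
        MatrixPhi4.IsRegular M (MatrixPhi4.slice θ μ₀ Ω M)) := by
  refine ⟨2, by norm_num, fun M hM => ?_⟩
  have hM0 : 0 < M := by linarith
  have hadd : ∀ {m n k l : MatrixPhi4.Idx} {h : Fin 2 → ℤ}, (∀ s, (n s : ℤ) = m s + h s) →
      (∀ s, (k s : ℤ) = l s + h s) → ∀ s, ((m s + k s : ℕ) : ℤ) = m s + l s + h s := by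
    intro m n k l h _ h2 s
    push_cast
    rw [h2 s]
    ring
  have hW := MatrixPhi4.tsum_jumpWeight_pos
  refine ⟨⟨θ * M ^ 2 / 4, by positivity, ?_⟩, ⟨θ * M ^ 2 / 4, 5 * M ^ 2, by positivity,
    by positivity, ?_⟩, ⟨θ * M ^ 2 / 4 * ∑' v, MatrixPhi4.jumpWeight v, by positivity,
    fun Ω hΩ i hi m p => MatrixPhi4.sum_slice_jump_le hθ hM hi hΩ m p⟩,
    ⟨θ * M ^ 2 / 4 * ∑' v, MatrixPhi4.jumpWeight v, by positivity,
    fun Ω hΩ i hi m => MatrixPhi4.exists_jump_maxima hθ hM hi hΩ m⟩,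
    fun Ω hΩ => MatrixPhi4.hasDelta0_slice hθ hM hΩ,
    fun Ω hΩ => ⟨MatrixPhi4.hasDelta0_slice hθ hM ⟨by linarith [hΩ.1], hΩ.2⟩,
      MatrixPhi4.hasDelta1_slice hθ hM hΩ⟩⟩
  · intro Ω hΩ i hi m n k l h h1 h2
    have := MatrixPhi4.slice_le_exp (μ₀ := μ₀) hθ hM hi hΩ m n k l
    rwa [MatrixPhi4.prod_exp_eq_norm1 _ _ _ (hadd h1 h2), ← neg_mul] at this
  · intro Ω hΩ i hi m n k l h h1 h2
    have := MatrixPhi4.slice_le_min (μ₀ := μ₀) hθ hM hi hΩ m n k l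
    rwa [Finset.prod_mul_distrib, MatrixPhi4.prod_exp_eq_norm1 _ _ _ (hadd h1 h2), ← neg_mul,
      ← mul_assoc] at this
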